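/- Let $(H,G)$ be a crossed module of topological groups, that is, topological groups $G$ and $H$ with a continuous homomorphism $t\colon G\to H$ and a continuous action $\alpha\colon H\to\mathrm{Aut}(G)$ of $H$ on $G$ by automorphisms such that $t(\alpha(h)(g))=h\,t(g)\,h^{-1}$ and $\alpha(t(g))=\mathrm{Ad}_g$ for all $g\in G$, $h\in H$. Suppose that the space $H$ is contractible. Then every (locally trivial, right) principal $G$-bundle $\pi\colon P\to M$ over a paracompact Hausdorff space $M$ admits an $(H,G)$ bibundle structure: there is a continuous map $\psi\colon P\to H$ with $\psi(pg)=\psi(p)\,t(g)$ for all $p\in P$, $g\in G$, so that each fibre of $\pi$, with the restriction of $\psi$, is an $(H,G)$ bispace (a space on which $G$ acts freely and transitively on the right, with a map $\psi$ to $H$ satisfying $\psi(xg)=\psi(x)t(g)$). -/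

import Mathlib

/-- A (topological) crossed module `G → H → Aut G`: topological groups `G` and `H`, a continuous
homomorphism `t : G → H` and an action `α` of `H` on `G` by automorphisms, continuous as a map
`H × G → G`, such that `t (α h g) = h t(g) h⁻¹` and `α (t g) = Ad g`. -/
structure CrossedModule (H G : Type*) [Group H] [TopologicalSpace H] [IsTopologicalGroup H]
    [Group G] [TopologicalSpace G] [IsTopologicalGroup G] where
  t : G →ₜ* H
  α : H →* MulAut G
  continuous_α : Continuous fun p : H × G => α p.1 p.2
  t_α : ∀ (h : H) (g : G), t (α h g) = h * t g * h⁻¹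
  α_t : ∀ g : G, α (t g) = MulAut.conj g

/-- `π : P → M` is a (right) principal `G`-bundle: `G` acts continuously on the right of `P`
(right actions are actions of `Gᵐᵒᵖ`), preserving the fibres of the continuous map `π`, and every
point of `M` has an open neighbourhood `U = e.baseSet` with a `G`-equivariant homeomorphism
`e : π ⁻¹(U) ≃ U × G` over `U`. -/
structure IsPrincipalBundle (G : Type*) [Group G] [TopologicalSpace G] {P M : Type*}
    [TopologicalSpace P] [TopologicalSpace M] [MulAction Gᵐᵒᵖ P] (π : P → M) : Prop where
  continuous_proj : Continuous π
  continuous_act : Continuous fun q : P × G => MulOpposite.op q.2 • q.1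
  proj_act : ∀ (p : P) (g : G), π (MulOpposite.op g • p) = π p
  locally_trivial : ∀ m : M, ∃ e : Bundle.Trivialization G π, m ∈ e.baseSet ∧
    ∀ p ∈ e.source, ∀ g : G, e (MulOpposite.op g • p) = ((e p).1, (e p).2 * g)

/-- The subset `X` of the right `G`-space `P`, with the restriction of `ψ` as structure map, is an
`(H, G)` bispace: `X` is non-empty and `G`-stable, `G` acts freely and transitively on it, and
`ψ (x g) = ψ x * t g` for `x ∈ X`. -/
structure CrossedModule.IsBispace {H G : Type*} [Group H] [TopologicalSpace H]
    [IsTopologicalGroup H] [Group G] [TopologicalSpace G] [IsTopologicalGroup G]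
    (𝒳 : CrossedModule H G) {P : Type*} [MulAction Gᵐᵒᵖ P] (X : Set P) (ψ : P → H) : Prop where
  nonempty : X.Nonempty
  stable : ∀ x ∈ X, ∀ g : G, MulOpposite.op g • x ∈ X
  free_transitive : ∀ x ∈ X, ∀ y ∈ X, ∃! g : G, MulOpposite.op g • x = y
  equivariant : ∀ x ∈ X, ∀ g : G, ψ (MulOpposite.op g • x) = ψ x * 𝒳.t g

/-- `(P → M, ψ)` is an `(H, G)` bibundle: `π : P → M` is a right principal `G`-bundle and
`ψ : P → H` is a continuous map, equivariant in the sense that `ψ (p g) = ψ p * t g`, such that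
each fibre of `π` is an `(H, G)` bispace. -/
structure CrossedModule.IsBibundle {H G : Type*} [Group H] [TopologicalSpace H]
    [IsTopologicalGroup H] [Group G] [TopologicalSpace G] [IsTopologicalGroup G]
    (𝒳 : CrossedModule H G) {P M : Type*} [TopologicalSpace P] [TopologicalSpace M]
    [MulAction Gᵐᵒᵖ P] (π : P → M) (ψ : P → H) : Prop where
  isPrincipalBundle : IsPrincipalBundle G π
  continuous_structureMap : Continuous ψ
  equivariant : ∀ (p : P) (g : G), ψ (MulOpposite.op g • p) = ψ p * 𝒳.t g
  bispace_fiber : ∀ m : M, 𝒳.IsBispace (π ⁻¹' {m}) ψ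

/-! Over a trivializing open set, `t` of the `G`-coordinate is an equivariant map to `H`. A
partition of unity on `M` glues these maps, provided `H` has a substitute for convex combinations
that commutes with right translation. A contraction of `H`, applied to the right-invariant
difference `a * b⁻¹`, interpolates between two points (`exists_equivariant_interpolation`);
iterating it over the finitely many indices of nonzero weight, in a fixed order, gives
`weightedGlue`. The weights are constant on fibres, so equivariance survives. -/

/-- A contractible topological group carries a continuous interpolation between its points which is
equivariant under right translations. -/
theorem exists_equivariant_interpolation (H : Type*) [Group H] [TopologicalSpace H]
    [IsTopologicalGroup H] [ContractibleSpace H] :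
    ∃ c : ℝ → H → H → H, (Continuous fun q : ℝ × H × H => c q.1 q.2.1 q.2.2) ∧
      (∀ s ≤ 0, ∀ a b, c s a b = a) ∧ (∀ s, 1 ≤ s → ∀ a b, c s a b = b) ∧
      ∀ s a b h, c s (a * h) (b * h) = c s a b * h := by
  obtain ⟨y, ⟨F⟩⟩ := id_nullhomotopic H
  -- `F` runs from the identity to the constant `y`; the factors `y` and `y⁻¹` make the endpoints
  -- exactly `a` and `b`.
  refine ⟨fun s a b => F (Set.projIcc (0 : ℝ) 1 zero_le_one s, a * b⁻¹ * y) * y⁻¹ * b,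
    ?_, ?_, ?_, ?_⟩
  · have hp : Continuous (Set.projIcc (0 : ℝ) 1 zero_le_one) := continuous_projIcc
    fun_prop
  · intro s hs a b
    have h0 : Set.projIcc (0 : ℝ) 1 zero_le_one s = 0 := Set.projIcc_of_le_left _ hs
    simp [h0]
  · intro s hs a b
    have h1 : Set.projIcc (0 : ℝ) 1 zero_le_one s = 1 := Set.projIcc_of_right_le _ hs
    simp [h1]
  · intro s a b h
    simp [mul_assoc]

section Glue

variable {ι X H : Type*}

/-- The iterated interpolation of the points `a i`, for `i` in a list, with weights `w i`. A point
of at least the total weight of those after it in the list replaces their interpolation. -/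
noncomputable def weightedGlue [One H] (c : ℝ → H → H → H) (w : ι → ℝ) (a : ι → H) : List ι → H
  | [] => 1
  | i :: l => c (2 * w i / (w i + (l.map w).sum)) (weightedGlue c w a l) (a i)

theorem sum_map_filter_ne_zero (w : ι → ℝ) (l : List ι) :
    ((l.filter fun i => w i ≠ 0).map w).sum = (l.map w).sum := by
  induction l with
  | nil => rfl
  | cons i l ih =>
    by_cases hi : w i = 0
    · simpa [hi] using ih
    · simpa [hi] using ih

theorem weightedGlue_filter [One H] {c : ℝ → H → H → H} (h0 : ∀ s ≤ 0, ∀ a b, c s a b = a)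
    (w : ι → ℝ) (a : ι → H) (l : List ι) :
    weightedGlue c w a (l.filter fun i => w i ≠ 0) = weightedGlue c w a l := by
  induction l with
  | nil => rfl
  | cons i l ih =>
    by_cases hi : w i = 0
    · rw [List.filter_cons_of_neg (by simpa using hi), ih, weightedGlue, h0 _ (by simp [hi])]
    · rw [List.filter_cons_of_pos (by simpa using hi), weightedGlue, weightedGlue, ih,
        sum_map_filter_ne_zero]

theorem sum_map_nonneg {w : ι → ℝ} (hw : ∀ i, 0 ≤ w i) (l : List ι) : 0 ≤ (l.map w).sum :=
  List.sum_nonneg (by simpa using fun i _ => hw i)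

/-- The default value `1` of the empty list is not equivariant; positive total weight ensures that
it is always overwritten. -/
theorem weightedGlue_mul_right [Group H] {c : ℝ → H → H → H} (h0 : ∀ s ≤ 0, ∀ a b, c s a b = a)
    (h1 : ∀ s, 1 ≤ s → ∀ a b, c s a b = b)
    (hc : ∀ s a b h, c s (a * h) (b * h) = c s a b * h) {w : ι → ℝ} (hw : ∀ i, 0 ≤ w i)
    {a a' : ι → H} {h : H} (ha : ∀ i, w i ≠ 0 → a' i = a i * h) (l : List ι)
    (hl : 0 < (l.map w).sum) :
    weightedGlue c w a' l = weightedGlue c w a l * h := by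
  induction l with
  | nil => simp at hl
  | cons i l ih =>
    rw [List.map_cons, List.sum_cons] at hl
    rw [weightedGlue, weightedGlue]
    rcases (sum_map_nonneg hw l).eq_or_lt with hs | hs
    · have hi : 0 < w i := by linarith
      have : 1 ≤ 2 * w i / (w i + (l.map w).sum) := by
        rw [← hs, add_zero, le_div_iff₀ hi]
        linarith
      rw [h1 _ this, h1 _ this, ha i hi.ne']
    · by_cases hi : w i = 0
      · rw [h0 _ (by simp [hi]), h0 _ (by simp [hi]), ih hs]
      · rw [ih hs, ha i hi, hc]

/-- Where the tail has weight zero its glue may be discontinuous. The parameter there is `2`, so it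
stays above `1` nearby and the glue is locally just `a i`; this is the purpose of the factor `2`. -/
theorem continuousOn_weightedGlue [TopologicalSpace X] [TopologicalSpace H] [One H]
    {c : ℝ → H → H → H} (hcont : Continuous fun q : ℝ × H × H => c q.1 q.2.1 q.2.2)
    (h1 : ∀ s, 1 ≤ s → ∀ a b, c s a b = b) {w : ι → X → ℝ} (hw : ∀ i x, 0 ≤ w i x)
    (hwc : ∀ i, Continuous (w i)) {a : ι → X → H} {s : Set X} (hs : IsOpen s) (l : List ι)
    (ha : ∀ i ∈ l, ContinuousOn (a i) s) :
    ContinuousOn (fun x => weightedGlue c (fun i => w i x) (fun i => a i x) l)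
      {x ∈ s | 0 < (l.map fun i => w i x).sum} := by
  have hsum : ∀ l : List ι, Continuous fun x => (l.map fun i => w i x).sum := fun l =>
    continuous_list_sum l fun i _ => hwc i
  induction l with
  | nil => simp
  | cons i l ih =>
    rintro x ⟨hxs, hx⟩
    apply ContinuousAt.continuousWithinAt
    rw [List.map_cons, List.sum_cons] at hx
    have hai : ContinuousAt (a i) x := (ha i (by simp)).continuousAt (hs.mem_nhds hxs)
    have hr : ContinuousAt (fun y => 2 * w i y / (w i y + (l.map fun i => w i y).sum)) x :=
      ((hwc i).continuousAt.const_mul 2).div ((hwc i).add (hsum l)).continuousAt hx.ne'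
    rcases (sum_map_nonneg (fun i => hw i x) l).eq_or_lt with h | h
    · have hi : 0 < w i x := by linarith
      have hx2 : 1 < 2 * w i x / (w i x + (l.map fun i => w i x).sum) := by
        rw [← h, add_zero, lt_div_iff₀ hi]
        linarith
      refine hai.congr ?_
      filter_upwards [hr.eventually_const_lt hx2] with y hy
      rw [weightedGlue, h1 _ hy.le]
    · have hopen : IsOpen {x ∈ s | 0 < (l.map fun i => w i x).sum} :=
        hs.inter (isOpen_lt continuous_const (hsum l))
      have hg := (ih fun j hj => ha j (List.mem_cons_of_mem _ hj)).continuousAt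
        (hopen.mem_nhds ⟨hxs, h⟩)
      exact hcont.continuousAt.comp (hr.prodMk (hg.prodMk hai))

end Glue

theorem Finset.sort_filter_congr {ι : Type*} [LinearOrder ι] {s t : Finset ι} (p : ι → Prop)
    [DecidablePred p] (h : s.filter p = t.filter p) :
    (s.sort).filter p = (t.sort).filter p := by
  refine List.Perm.eq_of_pairwise (le := (· ≤ ·)) (fun _ _ _ _ => le_antisymm)
    ((s.pairwise_sort _).filter _) ((t.pairwise_sort _).filter _) ?_
  rw [List.perm_ext_iff_of_nodup ((s.sort_nodup _).filter _) ((t.sort_nodup _).filter _)]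
  intro i
  simpa [and_comm] using Finset.ext_iff.1 h i

/-- Local equivariant maps to a contractible topological group, on the preimages of the members of
an open cover of a paracompact Hausdorff space, can be glued. -/
theorem exists_continuous_equivariant_of_local {G H P M : Type*} [Group H] [TopologicalSpace H]
    [IsTopologicalGroup H] [ContractibleSpace H] [TopologicalSpace P] [TopologicalSpace M]
    [ParacompactSpace M] [T2Space M] {π : P → M} (hπ : Continuous π) (act : G → P → P)
    (hact : ∀ g p, π (act g p) = π p) (t : G → H) {ι : Type*} (U : ι → Set M)
    (hU : ∀ i, IsOpen (U i)) (hcover : ∀ m, ∃ i, m ∈ U i) (a : ι → P → H)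
    (hac : ∀ i, ContinuousOn (a i) (π ⁻¹' U i))
    (ha : ∀ i p, π p ∈ U i → ∀ g, a i (act g p) = a i p * t g) :
    ∃ ψ : P → H, Continuous ψ ∧ ∀ g p, ψ (act g p) = ψ p * t g := by
  obtain ⟨c, hcont, h0, h1, hc⟩ := exists_equivariant_interpolation H
  obtain ⟨ρ, hρ⟩ := PartitionOfUnity.exists_isSubordinate isClosed_univ U hU
    (fun m _ => Set.mem_iUnion.2 (hcover m))
  -- The glue depends on the order of the indices, so one order is fixed globally.
  let _ : LinearOrder ι := IsWellOrder.linearOrder WellOrderingRel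
  classical
  let w : ι → P → ℝ := fun i p => ρ i (π p)
  have hw : ∀ i p, 0 ≤ w i p := fun i p => ρ.nonneg i _
  have hwc : ∀ i, Continuous (w i) := fun i => (ρ i).continuous.comp hπ
  have hwU : ∀ i p, w i p ≠ 0 → π p ∈ U i := fun i p hp => hρ i (subset_tsupport _ hp)
  have hpos : ∀ p (F : Finset ι), (∀ i, w i p ≠ 0 → i ∈ F) →
      0 < (F.sort.map fun i => w i p).sum := by
    intro p F hF
    obtain ⟨i, hi⟩ := ρ.exists_pos (Set.mem_univ (π p))
    refine lt_of_lt_of_le hi (List.single_le_sum (by simpa using fun i _ => hw i p) _ ?_)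
    exact List.mem_map.2 ⟨i, (Finset.mem_sort _).2 (hF i hi.ne'), rfl⟩
  let ψ : P → H := fun p =>
    weightedGlue c (fun i => w i p) (fun i => a i p) (ρ.finsupport (π p)).sort
  -- Indices of weight zero do not matter, so near a point the varying support can be replaced by
  -- one fixed finite set.
  have hψ : ∀ p (F : Finset ι), (∀ i, w i p ≠ 0 → i ∈ F) →
      ψ p = weightedGlue c (fun i => w i p) (fun i => a i p) F.sort := by
    intro p F hF
    refine (weightedGlue_filter h0 _ _ _).symm.trans
      (Eq.trans (congrArg _ ?_) (weightedGlue_filter h0 _ _ _))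
    refine Finset.sort_filter_congr _ ?_
    ext i
    simp only [Finset.mem_filter, ρ.mem_finsupport, Function.mem_support]
    exact ⟨fun h => ⟨hF i h.2, h.2⟩, fun h => ⟨h.2, h.2⟩⟩
  refine ⟨ψ, continuous_iff_continuousAt.2 fun p => ?_, fun g p => ?_⟩
  · obtain ⟨F, n, hn, hnU, hnF⟩ := ρ.exists_finset_nhds_support_subset hρ hU (π p)
    obtain ⟨n', hn', hn'o, hpn⟩ := mem_nhds_iff.1 hn
    have hso : IsOpen (π ⁻¹' n') := hn'o.preimage hπ
    have key := continuousOn_weightedGlue hcont h1 hw hwc (a := a) hso F.sort (fun i hi =>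
      (hac i).mono fun q hq => Set.mem_iInter₂.1 (hnU (hn' hq)) i ((Finset.mem_sort _).1 hi))
    have hF : ∀ q ∈ π ⁻¹' n', ∀ i, w i q ≠ 0 → i ∈ F := fun q hq i hi => hnF _ (hn' hq) hi
    have hcong : ContinuousOn ψ (π ⁻¹' n') := by
      refine (key.mono fun q hq => ⟨hq, hpos q F (hF q hq)⟩).congr fun q hq => ?_
      exact hψ q F (hF q hq)
    exact hcong.continuousAt (hso.mem_nhds hpn)
  · have hmem : ∀ i, w i p ≠ 0 → i ∈ ρ.finsupport (π p) := fun i hi =>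
      (ρ.mem_finsupport _).2 hi
    simp only [ψ, w, hact]
    exact weightedGlue_mul_right h0 h1 hc (hw · p) (fun i hi => ha i p (hwU i p hi) g) _
      (hpos p _ hmem)

theorem IsPrincipalBundle.fiber_nonempty {G P M : Type*} [Group G] [TopologicalSpace G]
    [TopologicalSpace P] [TopologicalSpace M] [MulAction Gᵐᵒᵖ P] {π : P → M}
    (hπ : IsPrincipalBundle G π) (m : M) : (π ⁻¹' {m}).Nonempty := by
  obtain ⟨e, hm, -⟩ := hπ.locally_trivial m
  exact ⟨e.toOpenPartialHomeomorph.symm (m, 1), e.proj_symm_apply' hm⟩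

theorem IsPrincipalBundle.existsUnique_smul_eq {G P M : Type*} [Group G] [TopologicalSpace G]
    [TopologicalSpace P] [TopologicalSpace M] [MulAction Gᵐᵒᵖ P] {π : P → M}
    (hπ : IsPrincipalBundle G π) {x y : P} (h : π x = π y) :
    ∃! g : G, MulOpposite.op g • x = y := by
  obtain ⟨e, hm, he⟩ := hπ.locally_trivial (π x)
  have hx : x ∈ e.source := e.mem_source.2 hm
  have hy : y ∈ e.source := e.mem_source.2 (h ▸ hm)
  refine ⟨(e x).2⁻¹ * (e y).2, ?_, fun g hg => ?_⟩
  · have hxg : MulOpposite.op ((e x).2⁻¹ * (e y).2) • x ∈ e.source :=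
      e.mem_source.2 (by rwa [hπ.proj_act])
    refine e.injOn hxg hy ?_
    refine (he x hx _).trans (Prod.ext ?_ (by simp))
    exact (e.coe_fst hx).trans (h.trans (e.coe_fst hy).symm)
  · have := congrArg Prod.snd (he x hx g)
    rw [hg] at this
    simp [this]

theorem mainTheorem8 {H G : Type*} [Group H] [TopologicalSpace H] [IsTopologicalGroup H]
    [Group G] [TopologicalSpace G] [IsTopologicalGroup G] (𝒳 : CrossedModule H G)
    [ContractibleSpace H]
    {P M : Type*} [TopologicalSpace P] [TopologicalSpace M] [ParacompactSpace M] [T2Space M]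
    [MulAction Gᵐᵒᵖ P] (π : P → M) (hπ : IsPrincipalBundle G π) :
    ∃ ψ : P → H, 𝒳.IsBibundle π ψ := by
  choose e hmem he using hπ.locally_trivial
  obtain ⟨ψ, hψ, hψg⟩ := exists_continuous_equivariant_of_local hπ.continuous_proj
    (fun (g : G) (p : P) => MulOpposite.op g • p) (fun g p => hπ.proj_act p g) 𝒳.t
    (fun m => (e m).baseSet) (fun m => (e m).open_baseSet) (fun m => ⟨m, hmem m⟩)
    (fun m p => 𝒳.t (e m p).2)
    (fun m => by
      rw [← (e m).source_eq]
      exact 𝒳.t.continuous_toFun.comp_continuousOn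
        (continuous_snd.comp_continuousOn (e m).continuousOn_toFun))
    (fun m p hp g => by
      simp only [he m p ((e m).mem_source.2 hp) g, map_mul])
  refine ⟨ψ, hπ, hψ, fun p g => hψg g p, fun m =>
    ⟨hπ.fiber_nonempty m, fun x hx g => (hπ.proj_act x g).trans hx,
      fun x hx y hy => hπ.existsUnique_smul_eq (Eq.trans hx (Eq.symm hy)), fun x _ g => hψg g x⟩⟩
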